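/- A non-ambiguous tree is a set of dotted cells of a rectangular grid with at least one row and one column (rows numbered from top to bottom, columns from left to right), such that every row and every column contains a dotted cell, and every dotted cell other than the top-left cell has either a dotted cell above it in the same column, or a dotted cell to its left in the same row, but not both. It is a complete non-ambiguous tree (CNAT) if, moreover, every dot either has both a dot below it in the same column and a dot to its right in the same row, or neither of these; in the latter case the dot is called a leaf dot. For $\pi = \pi_1\cdots\pi_n \in S_n$, a CNAT is said to be associated with $\pi$ if it fills an $n\times n$ grid and its leaf dots are exactly the cells in column $i$ and row $\pi_i$, for $1\le i\le n$. Let $\mathrm{cnat}(\pi)$ be the number of CNATs associated with $\pi$, and let $B(n,k) = \{\pi\in S_n : \mathrm{cnat}(\pi)=k\}$. For $j\in\{2,\dots,n\}$ and $\pi\in S_n$, let $\mathrm{Insert}_j(\pi)\in S_{n+1}$ be the permutation obtained from the word $\pi_1\cdots\pi_n$ by increasing every letter $\ge j$ by $1$ and then inserting the letter $j$ so that it becomes the $j$-th letter. (For example, $\mathrm{Insert}_3(521634) = 6231745$.) Theorem. Let $n\ge 2$, and define $\Phi:\{2,\dots,n\}\times S_n\to S_{n+1}$ by $\Phi(j,\pi)=\mathrm{Insert}_j(\pi)$.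 Then $\Phi$ restricts to a bijection from $\{2,\dots,n\}\times B(n,1)$ onto $B(n+1,2)$. -/

import Mathlib

/-- A cell of a grid with `m` rows and `n` columns is a pair `(column, row)`. Columns are numbered
from left to right and rows from top to bottom, both from `0`, so the top-left cell is `(0, 0)`. -/
abbrev GridCell (m n : ℕ) : Type := Fin n × Fin m

/-- The set `D` of dotted cells contains a dot above the cell `c`, in the same column. -/
def HasDotAbove {m n : ℕ} (D : Finset (GridCell m n)) (c : GridCell m n) : Prop :=
  ∃ r : Fin m, r < c.2 ∧ (c.1, r) ∈ D

/-- The set `D` of dotted cells contains a dot below the cell `c`, in the same column. -/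
def HasDotBelow {m n : ℕ} (D : Finset (GridCell m n)) (c : GridCell m n) : Prop :=
  ∃ r : Fin m, c.2 < r ∧ (c.1, r) ∈ D

/-- The set `D` of dotted cells contains a dot to the left of the cell `c`, in the same row. -/
def HasDotLeft {m n : ℕ} (D : Finset (GridCell m n)) (c : GridCell m n) : Prop :=
  ∃ k : Fin n, k < c.1 ∧ (k, c.2) ∈ D

/-- The set `D` of dotted cells contains a dot to the right of the cell `c`, in the same row. -/
def HasDotRight {m n : ℕ} (D : Finset (GridCell m n)) (c : GridCell m n) : Prop :=
  ∃ k : Fin n, c.1 < k ∧ (k, c.2) ∈ D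

/-- A non-ambiguous tree: a filling of an `m × n` grid, given by its set `D` of dotted cells. -/
structure IsNAT {m n : ℕ} (D : Finset (GridCell m n)) : Prop where
  row_nonempty : ∀ r : Fin m, ∃ k : Fin n, (k, r) ∈ D
  column_nonempty : ∀ k : Fin n, ∃ r : Fin m, (k, r) ∈ D
  /-- Aside from the top-left cell, every dotted cell has either a dot above it or a dot to its
  left, but not both. -/
  unique_parent : ∀ c ∈ D, ¬ ((c.1 : ℕ) = 0 ∧ (c.2 : ℕ) = 0) →
    Xor (HasDotAbove D c) (HasDotLeft D c)

/-- A complete non-ambiguous tree: every dot has both a dot below it and a dot to its right, or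
neither of these. -/
structure IsCNAT {m n : ℕ} (D : Finset (GridCell m n)) : Prop extends IsNAT D where
  complete : ∀ c ∈ D, (HasDotBelow D c ∧ HasDotRight D c) ∨ (¬ HasDotBelow D c ∧ ¬ HasDotRight D c)

/-- The leaf dots: those with no dot below them in their column or to their right in their row. -/
def leafDots {m n : ℕ} (D : Finset (GridCell m n)) : Set (GridCell m n) :=
  {c | c ∈ D ∧ ¬ HasDotBelow D c ∧ ¬ HasDotRight D c}

/-- The graphical representation of an `n`-permutation: the dot in column `i` is in row `π i`. -/
def permDots {n : ℕ} (π : Equiv.Perm (Fin n)) : Set (GridCell n n) :=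
  {c | c.2 = π c.1}

/-- The set of complete non-ambiguous trees whose associated permutation is `π`, that is, whose
leaf dots form the graphical representation of `π`. -/
def CNATs {n : ℕ} (π : Equiv.Perm (Fin n)) : Set (Finset (GridCell n n)) :=
  {D | IsCNAT D ∧ leafDots D = permDots π}

/-- The number of complete non-ambiguous trees with associated permutation `π`. -/
noncomputable def cnat {n : ℕ} (π : Equiv.Perm (Fin n)) : ℕ :=
  (CNATs π).ncard

/-- The set of `n`-permutations associated with exactly `k` complete non-ambiguous trees. -/
def permsWithCNATs (n k : ℕ) : Set (Equiv.Perm (Fin n)) :=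
  {π | cnat π = k}

/-- Insertion of a fixed point `p` into `π`: the new permutation maps `p` to `p`, and
`p.succAbove i` to `p.succAbove (π i)`; so positions and letters that are `≥ p` go up by one. -/
def insertFixedPoint {n : ℕ} (p : Fin (n + 1)) (π : Equiv.Perm (Fin n)) :
    Equiv.Perm (Fin (n + 1)) :=
  ((finSuccEquiv' p).trans π.optionCongr).trans (finSuccEquiv' p).symm

/-- The insertion operation at `j ∈ {2, …, n}`. The index `j` counts positions and letters from `1`,
so it corresponds to the element `j - 1` of `Fin (n + 1)`. -/
def insertOp {n : ℕ} (j : Set.Icc 2 n) (π : Equiv.Perm (Fin n)) : Equiv.Perm (Fin (n + 1)) :=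
  insertFixedPoint ⟨(j : ℕ) - 1, Nat.lt_succ_of_le ((Nat.sub_le _ _).trans j.2.2)⟩ π

/-! Let `S` = `permCells π`: the leaves and the inversions of `π`. A forest is a subset of `S` that
contains the leaves and has no dot with two parents. Its dots plus its roots number `2 * n`, so the
CNATs of `π` are the forests with `2 * n - 1` dots. If `π` is indecomposable, a maximal forest has a
single root, so every forest extends to a CNAT (`IsForest.exists_CNAT`). In particular every cell of
`S` lies in some CNAT.

Hence `cnat π = 1` iff `π` is indecomposable and `S` has `2 * n - 1` cells. Also `cnat π = 2` iff
`π` is indecomposable, `S` has `2 * n` cells and `π` has a decreasing triple `a < i < c`: the two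
CNATs omit `(a, π i)` and `(i, π c)` respectively, so the triple is unique.

Uniqueness forces the middle `i` to be a fixed point, and deleting it removes three cells of `S`,
which takes `2 * (n + 1)` to `2 * n - 1`. Conversely, when `cnat π = 1`, a fixed point inserted at
an interior cut is the middle of exactly one such triple (`exists_crossing_inversion`). Injectivity
holds because the inserted point is recovered as that middle. -/

/-- The cells that a CNAT associated with `π` may use: those of the graphical representation of
`π`, and the inversions of `π`. -/
def permCells {n : ℕ} (π : Equiv.Perm (Fin n)) : Finset (GridCell n n) :=
  Finset.univ.filter fun c => c.2 ≤ π c.1 ∧ c.1 ≤ π.symm c.2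

/-- A set of dots that contains the graphical representation of `π`, uses only admissible cells,
and in which no dot has both a dot above it and a dot to its left. -/
structure IsForest {n : ℕ} (π : Equiv.Perm (Fin n)) (D : Finset (GridCell n n)) : Prop where
  leaf_mem : ∀ i, (i, π i) ∈ D
  subset : D ⊆ permCells π
  not_both : ∀ {i i' r r'}, (i, r) ∈ D → i' < i → (i', r) ∈ D → r' < r → (i, r') ∈ D → False

/-- The cell `c` has neither a dot above it nor a dot to its left. -/
def IsRoot {n : ℕ} (D : Finset (GridCell n n)) (c : GridCell n n) : Prop :=
  (∀ r < c.2, (c.1, r) ∉ D) ∧ ∀ k < c.1, (k, c.2) ∉ D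

/-- A permutation that preserves no proper nonempty initial segment. -/
def IsIndecomposable {n : ℕ} (π : Equiv.Perm (Fin n)) : Prop :=
  ∀ k : ℕ, 0 < k → k < n → ∃ i : Fin n, (i : ℕ) < k ∧ k ≤ π i

/-! ### Forests, their roots and CNATs -/

section
variable {n : ℕ} {π : Equiv.Perm (Fin n)} {D : Finset (GridCell n n)}

theorem mem_permCells {i r : Fin n} :
    (i, r) ∈ permCells π ↔ r ≤ π i ∧ i ≤ π.symm r := by
  simp [permCells]

theorem leaf_mem_permCells (i : Fin n) : (i, π i) ∈ permCells π := by
  simp [mem_permCells]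

theorem IsForest.le_perm (h : IsForest π D) {i r : Fin n} (hc : (i, r) ∈ D) : r ≤ π i :=
  (mem_permCells.1 (h.subset hc)).1

theorem IsForest.le_symm (h : IsForest π D) {i r : Fin n} (hc : (i, r) ∈ D) : i ≤ π.symm r :=
  (mem_permCells.1 (h.subset hc)).2

theorem exists_leftmost (D : Finset (GridCell n n)) {i r : Fin n} (h : (i, r) ∈ D) :
    ∃ k ≤ i, (k, r) ∈ D ∧ ∀ j < k, (j, r) ∉ D := by
  induction i using WellFoundedLT.induction with
  | ind i ih =>
    by_cases hi : ∃ j < i, (j, r) ∈ D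
    · obtain ⟨j, hj, hjD⟩ := hi
      obtain ⟨k, hk, h1, h2⟩ := ih j hj hjD
      exact ⟨k, hk.trans hj.le, h1, h2⟩
    · push Not at hi
      exact ⟨i, le_rfl, h, hi⟩

theorem exists_topmost (D : Finset (GridCell n n)) {i r : Fin n} (h : (i, r) ∈ D) :
    ∃ k ≤ r, (i, k) ∈ D ∧ ∀ j < k, (i, j) ∉ D := by
  induction r using WellFoundedLT.induction with
  | ind r ih =>
    by_cases hi : ∃ j < r, (i, j) ∈ D
    · obtain ⟨j, hj, hjD⟩ := hi
      obtain ⟨k, hk, h1, h2⟩ := ih j hj hjD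
      exact ⟨k, hk.trans hj.le, h1, h2⟩
    · push Not at hi
      exact ⟨r, le_rfl, h, hi⟩

theorem exists_rightmost (D : Finset (GridCell n n)) {i r : Fin n} (h : (i, r) ∈ D) :
    ∃ k ≥ i, (k, r) ∈ D ∧ ∀ j > k, (j, r) ∉ D := by
  induction i using WellFoundedGT.induction with
  | ind i ih =>
    by_cases hi : ∃ j > i, (j, r) ∈ D
    · obtain ⟨j, hj, hjD⟩ := hi
      obtain ⟨k, hk, h1, h2⟩ := ih j hj hjD
      exact ⟨k, hj.le.trans hk, h1, h2⟩
    · push Not at hi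
      exact ⟨i, le_rfl, h, hi⟩

theorem exists_bottommost (D : Finset (GridCell n n)) {i r : Fin n} (h : (i, r) ∈ D) :
    ∃ k ≥ r, (i, k) ∈ D ∧ ∀ j > k, (i, j) ∉ D := by
  induction r using WellFoundedGT.induction with
  | ind r ih =>
    by_cases hi : ∃ j > r, (i, j) ∈ D
    · obtain ⟨j, hj, hjD⟩ := hi
      obtain ⟨k, hk, h1, h2⟩ := ih j hj hjD
      exact ⟨k, hj.le.trans hk, h1, h2⟩
    · push Not at hi
      exact ⟨r, le_rfl, h, hi⟩

/-- Every dot of a set with complete dots and with leaf dots given by `π` is admissible. -/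
theorem subset_permCells_of_complete
    (hc : ∀ c ∈ D, (HasDotBelow D c ∧ HasDotRight D c) ∨ (¬ HasDotBelow D c ∧ ¬ HasDotRight D c))
    (hl : leafDots D = permDots π) : D ⊆ permCells π := by
  rintro ⟨i, r⟩ h
  rw [mem_permCells]
  have key : ∀ c ∈ D, (¬ HasDotBelow D c ∨ ¬ HasDotRight D c) → c.2 = π c.1 := by
    intro c hcD hn
    have : c ∈ leafDots D := by
      have := hc c hcD
      exact ⟨hcD, by tauto⟩
    rw [hl] at this
    exact this
  constructor
  · obtain ⟨k, hk, h1, h2⟩ := exists_bottommost D h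
    have := key (i, k) h1 (Or.inl fun ⟨j, hj, hjD⟩ => h2 j hj hjD)
    simp only at this
    exact this ▸ hk
  · obtain ⟨k, hk, h1, h2⟩ := exists_rightmost D h
    have := key (k, r) h1 (Or.inr fun ⟨j, hj, hjD⟩ => h2 j hj hjD)
    simp only at this
    rw [this]
    simpa using hk

/-- Completeness is automatic in a forest: a dot that is not a leaf has the leaf of its column below
it and the leaf of its row to its right. -/
theorem IsForest.complete (h : IsForest π D) {c : GridCell n n} (hc : c ∈ D) :
    (c.2 ≠ π c.1 ∧ HasDotBelow D c ∧ HasDotRight D c) ∨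
      (c.2 = π c.1 ∧ ¬ HasDotBelow D c ∧ ¬ HasDotRight D c) := by
  obtain ⟨i, r⟩ := c
  by_cases hr : r = π i
  · subst hr
    refine Or.inr ⟨rfl, ?_, ?_⟩
    · rintro ⟨s, hs, hsD⟩
      exact absurd (h.le_perm hsD) (not_le.2 hs)
    · rintro ⟨s, hs, hsD⟩
      have := h.le_symm hsD
      simp only [Equiv.symm_apply_apply] at this
      exact absurd this (not_le.2 hs)
  · refine Or.inl ⟨hr, ⟨π i, lt_of_le_of_ne (h.le_perm hc) hr, h.leaf_mem i⟩,
      ⟨π.symm r, lt_of_le_of_ne (h.le_symm hc) ?_, by simpa using h.leaf_mem (π.symm r)⟩⟩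
    rintro rfl
    simp at hr

/-- CNATs associated with `π` are the forests whose only root is the top-left cell. -/
theorem mem_CNATs_iff : D ∈ CNATs π ↔
    IsForest π D ∧ ∀ c ∈ D, IsRoot D c → (c.1 : ℕ) = 0 ∧ (c.2 : ℕ) = 0 := by
  constructor
  · rintro ⟨h, hl⟩
    refine ⟨⟨fun i => ?_, subset_permCells_of_complete h.complete hl, ?_⟩, ?_⟩
    · have : ((i, π i) : GridCell n n) ∈ leafDots D := hl ▸ rfl
      exact this.1
    · intro i i' r r' h0 hi hi' hr hr'
      have := h.unique_parent (i, r) h0 (by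
        rintro ⟨h1, -⟩
        have : (i' : ℕ) < i := hi
        simp only at h1
        omega)
      rcases this with ⟨-, h2⟩ | ⟨-, h2⟩
      · exact h2 ⟨i', hi, hi'⟩
      · exact h2 ⟨r', hr, hr'⟩
    · intro c hc hroot
      by_contra h0
      rcases h.unique_parent c hc h0 with ⟨⟨r, h1, h2⟩, -⟩ | ⟨⟨r, h1, h2⟩, -⟩
      · exact hroot.1 r h1 h2
      · exact hroot.2 r h1 h2
  · rintro ⟨h, hroot⟩
    refine ⟨⟨⟨fun r => ⟨π.symm r, by simpa using h.leaf_mem (π.symm r)⟩,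
      fun k => ⟨_, h.leaf_mem k⟩, ?_⟩, ?_⟩, ?_⟩
    · intro c hc h0
      by_cases ha : HasDotAbove D c
      · refine Or.inl ⟨ha, ?_⟩
        rintro ⟨k, hk, hkD⟩
        obtain ⟨r, hr, hrD⟩ := ha
        exact h.not_both hc hk hkD hr hrD
      · refine Or.inr ⟨?_, ha⟩
        by_contra hl
        exact h0 (hroot c hc ⟨fun r h1 h2 => ha ⟨r, h1, h2⟩, fun r h1 h2 => hl ⟨r, h1, h2⟩⟩)
    · intro c hc
      have := h.complete hc
      tauto
    · ext c
      constructor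
      · rintro ⟨h1, h2, h3⟩
        have := h.complete h1
        simp only [permDots, Set.mem_ofPred_eq]
        tauto
      · rintro hc
        simp only [permDots, Set.mem_ofPred_eq] at hc
        have hcD : c ∈ D := by
          have := h.leaf_mem c.1
          rwa [← hc] at this
        have := h.complete hcD
        exact ⟨hcD, by tauto⟩

open Classical in
/-- Counting rows by their leftmost dots and columns by their topmost dots. -/
theorem IsForest.card_add_card_roots (h : IsForest π D) :
    D.card + (D.filter (IsRoot D)).card = 2 * n := by
  have hA : (D.filter fun c => ∀ r < c.2, (c.1, r) ∉ D).card = n := by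
    refine (Finset.card_bij (t := Finset.univ) (fun c _ => c.1) (by simp) ?_ ?_).trans
      (Finset.card_fin n)
    · rintro ⟨i, r⟩ h1 ⟨j, s⟩ h2 (rfl : i = j)
      simp only [Finset.mem_filter] at h1 h2
      congr 1
      rcases lt_trichotomy r s with hrs | hrs | hrs
      · exact absurd h1.1 (h2.2 r hrs)
      · exact hrs
      · exact absurd h2.1 (h1.2 s hrs)
    · intro i _
      obtain ⟨k, -, h1, h2⟩ := exists_topmost D (h.leaf_mem i)
      exact ⟨(i, k), by simpa using ⟨h1, h2⟩, rfl⟩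
  have hL : (D.filter fun c => ∀ k < c.1, (k, c.2) ∉ D).card = n := by
    refine (Finset.card_bij (t := Finset.univ) (fun c _ => c.2) (by simp) ?_ ?_).trans
      (Finset.card_fin n)
    · rintro ⟨i, r⟩ h1 ⟨j, s⟩ h2 (rfl : r = s)
      simp only [Finset.mem_filter] at h1 h2
      congr 1
      rcases lt_trichotomy i j with hrs | hrs | hrs
      · exact absurd h1.1 (h2.2 i hrs)
      · exact hrs
      · exact absurd h2.1 (h1.2 j hrs)
    · intro r _
      obtain ⟨k, -, h1, h2⟩ := exists_leftmost D (i := π.symm r) (r := r)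
        (by simpa using h.leaf_mem (π.symm r))
      exact ⟨(k, r), by simpa using ⟨h1, h2⟩, rfl⟩
  -- No dot has two parents, so each dot is topmost in its column or leftmost in its row; the roots
  -- are the dots that are both.
  have hU : D = (D.filter fun c => ∀ r < c.2, (c.1, r) ∉ D) ∪
      D.filter fun c => ∀ k < c.1, (k, c.2) ∉ D := by
    rw [← Finset.filter_or, Finset.filter_true_of_mem]
    intro c hc
    by_contra hn
    push Not at hn
    obtain ⟨⟨r, hr, hrD⟩, ⟨k, hk, hkD⟩⟩ := hn
    exact h.not_both hc hk hkD hr hrD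
  have hI : D.filter (IsRoot D) = (D.filter fun c => ∀ r < c.2, (c.1, r) ∉ D) ∩
      D.filter fun c => ∀ k < c.1, (k, c.2) ∉ D := by
    rw [← Finset.filter_and]
    exact Finset.filter_congr fun _ _ => Iff.rfl
  have := Finset.card_union_add_card_inter (D.filter fun c => ∀ r < c.2, (c.1, r) ∉ D)
    (D.filter fun c => ∀ k < c.1, (k, c.2) ∉ D)
  rw [← hI, ← hU, hA, hL] at this
  omega

/-- CNATs associated with `π` are the forests with `2 * n - 1` dots. -/
theorem mem_CNATs_iff_card (hn : 0 < n) : D ∈ CNATs π ↔ IsForest π D ∧ D.card + 1 = 2 * n := by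
  classical
  rw [mem_CNATs_iff]
  refine and_congr_right fun h => ?_
  have hcard := h.card_add_card_roots
  -- The first row and the first column each contain a root; a single root must therefore be the
  -- top-left cell.
  obtain ⟨i, -, hi, hi'⟩ := exists_leftmost D (i := π.symm ⟨0, hn⟩) (r := ⟨0, hn⟩)
    (by simpa using h.leaf_mem (π.symm ⟨0, hn⟩))
  have hiroot : IsRoot D (i, ⟨0, hn⟩) := ⟨fun r hr => absurd hr (by simp [Fin.lt_def]), hi'⟩
  obtain ⟨r, -, hr, hr'⟩ := exists_topmost D (h.leaf_mem ⟨0, hn⟩)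
  have hrroot : IsRoot D (⟨0, hn⟩, r) := ⟨hr', fun r hr => absurd hr (by simp [Fin.lt_def])⟩
  constructor
  · intro hroot
    have : D.filter (IsRoot D) = {(i, ⟨0, hn⟩)} := by
      have h1 := hroot _ hi hiroot
      ext c
      simp only [Finset.mem_filter, Finset.mem_singleton]
      constructor
      · rintro ⟨hc, hcr⟩
        have h2 := hroot c hc hcr
        ext
        · simp only at h1 ⊢; omega
        · simp only at h1 ⊢; omega
      · rintro rfl
        exact ⟨hi, hiroot⟩
    rw [this, Finset.card_singleton] at hcard
    exact hcard
  · intro hD c hc hcroot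
    have h1 : (D.filter (IsRoot D)).card ≤ 1 := by omega
    rw [Finset.card_le_one] at h1
    have h2 := h1 c (by simp [hc, hcroot]) _ (by simpa using ⟨hi, hiroot⟩)
    have h3 := h1 c (by simp [hc, hcroot]) _ (by simpa using ⟨hr, hrroot⟩)
    exact ⟨by rw [h3], by rw [h2]⟩

end

/-! ### Extending forests to CNATs; permutations with one CNAT -/

section
variable {n : ℕ} {π : Equiv.Perm (Fin n)} {D : Finset (GridCell n n)}

/-- If a forest is maximal, then every column to the left of a root has its leaf above the root. -/
theorem IsForest.perm_le_of_root (h : IsForest π D)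
    (hmax : ∀ x ∈ permCells π, IsForest π (insert x D) → x ∈ D)
    {i r : Fin n} (hir : (i, r) ∈ D) (hroot : IsRoot D (i, r)) (k : Fin n) (hk : k < i) :
    π k ≤ r := by
  induction k using WellFoundedLT.induction with
  | ind k ih =>
    by_contra! hkr
    have hx : (k, r) ∈ permCells π := mem_permCells.2 ⟨hkr.le, hk.le.trans (h.le_symm hir)⟩
    -- Otherwise `(k, r)` could be added. As the upper parent of a dot of column `k` with a dot to
    -- its left, it is excluded by induction: columns before `k` end by row `r`. Its other possible
    -- corners contradict `hroot` or `h`.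
    refine hroot.2 k hk (hmax _ hx ⟨fun i => Finset.mem_insert_of_mem (h.leaf_mem i),
      Finset.insert_subset hx h.subset, ?_⟩)
    intro j j' s s' h0 hj hj' hs hs'
    simp only [Finset.mem_insert, Prod.mk.injEq] at h0 hj' hs'
    rcases h0 with ⟨rfl, rfl⟩ | h0
    · rcases hj' with ⟨rfl, -⟩ | hj'
      · exact lt_irrefl _ hj
      · exact hroot.2 j' (hj.trans hk) hj'
    · rcases hj' with ⟨rfl, rfl⟩ | hj'
      · rcases hs' with ⟨rfl, rfl⟩ | hs'
        · exact lt_irrefl _ hj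
        · rcases lt_trichotomy j i with hji | rfl | hji
          · exact hroot.2 j hji h0
          · exact hroot.1 s' hs hs'
          · exact h.not_both h0 hji hir hs hs'
      · rcases hs' with ⟨rfl, rfl⟩ | hs'
        · exact absurd (ih j' hj (hj.trans hk)) (not_le.2 (hs.trans_le (h.le_perm hj')))
        · exact h.not_both h0 hj hj' hs hs'

/-- If a forest is maximal, then every row above a root has its leaf to the left of the root. -/
theorem IsForest.symm_le_of_root (h : IsForest π D)
    (hmax : ∀ x ∈ permCells π, IsForest π (insert x D) → x ∈ D)
    {i r : Fin n} (hir : (i, r) ∈ D) (hroot : IsRoot D (i, r)) (k : Fin n) (hk : k < r) :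
    π.symm k ≤ i := by
  induction k using WellFoundedLT.induction with
  | ind k ih =>
    by_contra! hki
    have hx : (i, k) ∈ permCells π := mem_permCells.2 ⟨hk.le.trans (h.le_perm hir), hki.le⟩
    refine hroot.1 k hk (hmax _ hx ⟨fun i => Finset.mem_insert_of_mem (h.leaf_mem i),
      Finset.insert_subset hx h.subset, ?_⟩)
    intro j j' s s' h0 hj hj' hs hs'
    simp only [Finset.mem_insert, Prod.mk.injEq] at h0 hj' hs'
    rcases h0 with ⟨rfl, rfl⟩ | h0
    · rcases hs' with ⟨-, rfl⟩ | hs'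
      · exact lt_irrefl _ hs
      · exact hroot.1 s' (hs.trans hk) hs'
    · rcases hs' with ⟨rfl, rfl⟩ | hs'
      · rcases hj' with ⟨rfl, rfl⟩ | hj'
        · exact lt_irrefl _ hs
        · rcases lt_trichotomy s r with hji | rfl | hji
          · exact hroot.1 s hji h0
          · exact hroot.2 j' hj hj'
          · exact h.not_both h0 hj hj' hji hir
      · rcases hj' with ⟨rfl, rfl⟩ | hj'
        · exact absurd (ih s' hs (hs.trans hk)) (not_le.2 (hj.trans_le (h.le_symm hs')))
        · exact h.not_both h0 hj hj' hs hs'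

/-- At a root `(i, r)`, `π` sends the columns before `i` into the rows above `r`, and its inverse
does the opposite. So `i = r` and `π` preserves an initial segment, which must be empty. -/
theorem IsForest.mem_CNATs_of_maximal (hπ : IsIndecomposable π) (h : IsForest π D)
    (hmax : ∀ x ∈ permCells π, IsForest π (insert x D) → x ∈ D) : D ∈ CNATs π := by
  rw [mem_CNATs_iff]
  refine ⟨h, ?_⟩
  rintro ⟨i, r⟩ hir hroot
  have h1 : ∀ k < i, π k < r := fun k hk => lt_of_le_of_ne (h.perm_le_of_root hmax hir hroot k hk)
    (by
      rintro rfl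
      have := h.le_symm hir
      simp only [Equiv.symm_apply_apply] at this
      exact absurd hk (not_lt.2 this))
  have h2 : ∀ k < r, π.symm k < i := fun k hk =>
    lt_of_le_of_ne (h.symm_le_of_root hmax hir hroot k hk) (by
      rintro rfl
      have := h.le_perm hir
      simp only [Equiv.apply_symm_apply] at this
      exact absurd hk (not_lt.2 this))
  have h3 : (i : ℕ) ≤ r := by
    have := Finset.card_le_card_of_injOn (s := Finset.Iio i) (t := Finset.Iio r) π
      (fun k hk => by simpa using h1 k (by simpa using hk)) π.injective.injOn
    simpa using this
  have h4 : (r : ℕ) ≤ i := by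
    have := Finset.card_le_card_of_injOn (s := Finset.Iio r) (t := Finset.Iio i) π.symm
      (fun k hk => by simpa using h2 k (by simpa using hk)) π.symm.injective.injOn
    simpa using this
  by_contra hne
  simp only at hne
  obtain ⟨k, hk, hk'⟩ := hπ i (by omega) i.2
  have := h1 k hk
  rw [Fin.lt_def] at this
  omega

/-- Every forest on an indecomposable permutation extends to a CNAT. -/
theorem IsForest.exists_CNAT (hπ : IsIndecomposable π) (h : IsForest π D) :
    ∃ D' ∈ CNATs π, D ⊆ D' := by
  obtain ⟨D', hD, hmax⟩ := (Set.toFinite {D | IsForest π D}).exists_le_maximal h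
  refine ⟨D', hmax.prop.mem_CNATs_of_maximal hπ fun x _ hx => ?_, hD⟩
  exact hmax.le_of_ge hx (Finset.subset_insert x D') (Finset.mem_insert_self x D')

/-- The dots that belong to every forest. -/
def leaves (π : Equiv.Perm (Fin n)) : Finset (GridCell n n) :=
  Finset.univ.image fun i => (i, π i)

theorem mem_leaves {i r : Fin n} : (i, r) ∈ leaves π ↔ r = π i := by
  simp [leaves, eq_comm]

theorem not_right_of_leaf {i r i' : Fin n} (h : (i, r) ∈ permCells π) (hi : i' < i) :
    r ≠ π i' := by
  rintro rfl
  have := (mem_permCells.1 h).2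
  simp only [Equiv.symm_apply_apply] at this
  exact absurd hi (not_lt.2 this)

theorem not_below_of_leaf {i r r' : Fin n} (h : (i, r) ∈ permCells π) (hi : r' < r) :
    r' ≠ π i := by
  rintro rfl
  exact absurd hi (not_lt.2 (mem_permCells.1 h).1)

/-- A leaf is never to the left of or above an admissible cell, so both parents of a bad dot would
have to be `x`. -/
theorem isForest_insert_leaves {x : GridCell n n} (hx : x ∈ permCells π) :
    IsForest π (insert x (leaves π)) := by
  have hsub : insert x (leaves π) ⊆ permCells π := by
    refine Finset.insert_subset hx ?_
    rintro ⟨i, r⟩ h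
    rw [mem_leaves] at h
    exact h ▸ leaf_mem_permCells i
  refine ⟨fun i => Finset.mem_insert_of_mem (mem_leaves.2 rfl), hsub, ?_⟩
  intro i i' r r' h0 hi hi' hr hr'
  have h1 := not_right_of_leaf (hsub h0) hi
  have h2 := not_below_of_leaf (hsub h0) hr
  simp only [Finset.mem_insert, mem_leaves, h1, h2, or_false] at hi' hr'
  rw [← hr'] at hi'
  simp only [Prod.mk.injEq] at hi'
  exact hi.ne hi'.1

/-- If two admissible cells cannot be added together to the leaves, then together with a leaf
they form a corner. -/
theorem corner_of_not_isForest {x y : GridCell n n} (hx : x ∈ permCells π) (hy : y ∈ permCells π)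
    (h : ¬ IsForest π (insert x (insert y (leaves π)))) : x.2 = π y.1 ∨ y.2 = π x.1 := by
  by_contra! hne
  have hsub : insert x (insert y (leaves π)) ⊆ permCells π :=
    Finset.insert_subset hx (isForest_insert_leaves hy).subset
  refine h ⟨fun i => by simp [mem_leaves], hsub, ?_⟩
  intro i i' r r' h0 hi hi' hr hr'
  have h1 := not_right_of_leaf (hsub h0) hi
  have h2 := not_below_of_leaf (hsub h0) hr
  simp only [Finset.mem_insert, mem_leaves, h1, h2, or_false] at hi' hr' h0
  grind

theorem exists_CNAT_mem (hπ : IsIndecomposable π) {x : GridCell n n} (hx : x ∈ permCells π) :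
    ∃ D ∈ CNATs π, x ∈ D := by
  obtain ⟨D, hD, hsub⟩ := (isForest_insert_leaves hx).exists_CNAT hπ
  exact ⟨D, hD, hsub (Finset.mem_insert_self _ _)⟩

/-- If the first `k` positions were preserved, the leftmost dot of row `k` would lie in a column `≥
k`, where no admissible cell is above row `k`: a second root. -/
theorem isIndecomposable_of_mem_CNATs (hD : D ∈ CNATs π) : IsIndecomposable π := by
  rw [mem_CNATs_iff] at hD
  obtain ⟨h, hroot⟩ := hD
  intro k hk hkn
  by_contra! hlt
  have hsymm : ∀ r : Fin n, (r : ℕ) < k → (π.symm r : ℕ) < k := by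
    intro r hr
    have hsurj : Set.SurjOn π (Finset.Iio (⟨k, hkn⟩ : Fin n)) (Finset.Iio (⟨k, hkn⟩ : Fin n)) :=
      Finset.surjOn_of_injOn_of_card_le π
        (fun i hi => by simpa [Fin.lt_def] using hlt i (by simpa [Fin.lt_def] using hi))
        π.injective.injOn le_rfl
    obtain ⟨i, hi, rfl⟩ := hsurj (a := r) (by simpa [Fin.lt_def] using hr)
    simpa [Fin.lt_def] using hi
  obtain ⟨i, -, hi, hi'⟩ := exists_leftmost D (i := π.symm ⟨k, hkn⟩) (r := ⟨k, hkn⟩)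
    (by simpa using h.leaf_mem (π.symm ⟨k, hkn⟩))
  have hki : k ≤ i := by
    by_contra! hik
    have h1 := hlt i hik
    have h2 := h.le_perm hi
    rw [Fin.le_def] at h2
    simp only at h2
    omega
  have := (hroot _ hi ⟨fun r hr hrD => ?_, hi'⟩).2
  · simp only at this
    omega
  · have h1 := h.le_symm hrD
    have h2 := hsymm r hr
    rw [Fin.le_def] at h1
    simp only at h1
    omega

theorem cnat_eq_one_iff (hn : 0 < n) :
    cnat π = 1 ↔ IsIndecomposable π ∧ (permCells π).card + 1 = 2 * n := by
  constructor
  · intro h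
    obtain ⟨D, hD⟩ := Set.ncard_eq_one.1 h
    have hDm : D ∈ CNATs π := hD ▸ rfl
    have hπ := isIndecomposable_of_mem_CNATs hDm
    have hDf := (mem_CNATs_iff_card hn).1 hDm
    refine ⟨hπ, ?_⟩
    have : permCells π = D := by
      refine Finset.Subset.antisymm (fun x hx => ?_) hDf.1.subset
      obtain ⟨D', hD', hxD⟩ := exists_CNAT_mem hπ hx
      rw [hD] at hD'
      rwa [Set.mem_singleton_iff.1 hD'] at hxD
    rw [this, hDf.2]
  · rintro ⟨hπ, hcard⟩
    refine Set.ncard_eq_one.2 ⟨permCells π, ?_⟩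
    have hall : ∀ D ∈ CNATs π, D = permCells π := by
      intro D hD
      have hDf := (mem_CNATs_iff_card hn).1 hD
      exact Finset.eq_of_subset_of_card_le hDf.1.subset (by omega)
    obtain ⟨D, hD, -⟩ := exists_CNAT_mem hπ (leaf_mem_permCells (π := π) ⟨0, hn⟩)
    ext D'
    refine ⟨hall D', ?_⟩
    rintro rfl
    rwa [← hall D hD]

/-- A forest contains no rectangle. -/
theorem IsForest.not_rectangle (h : IsForest π D) {i i' r r' : Fin n} (hi : i ≠ i') (hr : r ≠ r')
    (h1 : (i, r) ∈ D) (h2 : (i, r') ∈ D) (h3 : (i', r) ∈ D) (h4 : (i', r') ∈ D) : False := by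
  rcases lt_or_gt_of_ne hi with hi | hi <;> rcases lt_or_gt_of_ne hr with hr | hr
  · exact h.not_both h4 hi h2 hr h3
  · exact h.not_both h3 hi h1 hr h4
  · exact h.not_both h2 hi h4 hr h1
  · exact h.not_both h1 hi h3 hr h2

end

/-! ### Permutations with two CNATs and decreasing triples -/

/-- The values of `π` at `a < i < c` form a decreasing sequence. -/
def Is321 {n : ℕ} (π : Equiv.Perm (Fin n)) (a i c : Fin n) : Prop :=
  a < i ∧ i < c ∧ π c < π i ∧ π i < π a

section
variable {n : ℕ} {π : Equiv.Perm (Fin n)} {D D₁ D₂ : Finset (GridCell n n)}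

theorem mem_permCells_of_inversion {i j : Fin n} (h : i < j) (h' : π j < π i) :
    (i, π j) ∈ permCells π :=
  mem_permCells.2 ⟨h'.le, by simpa using h.le⟩

theorem IsForest.exists_inversion_of_notMem (h₁ : IsForest π D₁) (h₂ : IsForest π D₂)
    {x : GridCell n n} (hx : x ∈ D₁ \ D₂) : ∃ i j, x = (i, π j) ∧ i < j ∧ π j < π i := by
  obtain ⟨i, r⟩ := x
  rw [Finset.mem_sdiff] at hx
  obtain ⟨j, rfl⟩ := π.surjective r
  have hne : i ≠ j := by
    rintro rfl
    exact hx.2 (h₂.leaf_mem i)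
  refine ⟨i, j, rfl, lt_of_le_of_ne ?_ hne, lt_of_le_of_ne (h₁.le_perm hx.1) ?_⟩
  · simpa using h₁.le_symm hx.1
  · exact fun h => hne (π.injective h.symm)

/-- If `x` and `y` were compatible, some CNAT would contain both, but each of the two CNATs omits
one of them. -/
theorem corner_of_CNATs_eq_pair (hπ : IsIndecomposable π) (h : CNATs π = {D₁, D₂})
    (h₁ : IsForest π D₁) (h₂ : IsForest π D₂) {x y : GridCell n n}
    (hx : x ∈ D₁ \ D₂) (hy : y ∈ D₂ \ D₁) : x.2 = π y.1 ∨ y.2 = π x.1 := by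
  rw [Finset.mem_sdiff] at hx hy
  refine corner_of_not_isForest (h₁.subset hx.1) (h₂.subset hy.1) fun hf => ?_
  obtain ⟨D, hD, hsub⟩ := hf.exists_CNAT hπ
  have hxD : x ∈ D := hsub (by simp)
  have hyD : y ∈ D := hsub (by simp)
  rw [h] at hD
  rcases hD with rfl | rfl
  · exact hy.2 hyD
  · exact hx.2 hxD

/-- Excludes CNATs that differ in two or more cells each way: their differences would all be corners
at one leaf, and `D₁` would then contain a rectangle. -/
theorem not_corner_of_two_le (h₁ : IsForest π D₁) (h₂ : IsForest π D₂)
    (hS : ∀ z ∈ permCells π, z ∈ D₁ ∨ z ∈ D₂)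
    (hK : ∀ x ∈ D₁ \ D₂, ∀ y ∈ D₂ \ D₁, x.2 = π y.1 ∨ y.2 = π x.1)
    {x x' y y' : GridCell n n} (hx : x ∈ D₁ \ D₂) (hx' : x' ∈ D₁ \ D₂) (hxx : x ≠ x')
    (hy : y ∈ D₂ \ D₁) (hy' : y' ∈ D₂ \ D₁) (hyy : y ≠ y') : x.2 ≠ π y.1 := by
  intro hxy
  have k1 := hK x' hx' y hy
  have k2 := hK x hx y' hy'
  have k3 := hK x' hx' y' hy'
  obtain ⟨a, b, rfl, hab, hab'⟩ := h₁.exists_inversion_of_notMem h₂ hx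
  obtain ⟨b', c, rfl, hbc, hbc'⟩ := h₂.exists_inversion_of_notMem h₁ hy
  obtain ⟨a₂, b₂, rfl, hab₂, hab₂'⟩ := h₁.exists_inversion_of_notMem h₂ hx'
  obtain ⟨b₃, c₃, rfl, hbc₃, hbc₃'⟩ := h₂.exists_inversion_of_notMem h₁ hy'
  simp only [EmbeddingLike.apply_eq_iff_eq] at hxy k1 k2 k3
  subst hxy
  have hmain : b₂ = b ∧ b₃ = b := by grind
  obtain ⟨rfl, rfl⟩ := hmain
  have haa : a ≠ a₂ := by grind
  have hcc : c ≠ c₃ := by grind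
  -- Outside `D₁`, such a cell would lie in `D₂ \ D₁` and form a corner with `x`, which the order of
  -- the columns forbids.
  have hD₁ : ∀ a' c', a' < b₃ → b₃ < c' → π b₃ < π a' → π c' < π b₃ → (a', π c') ∈ D₁ := by
    intro a' c' h1 h2 h3 h4
    by_contra hn
    have hz : (a', π c') ∈ permCells π := mem_permCells_of_inversion (h1.trans h2) (h4.trans h3)
    have := hK _ hx (a', π c') (by simpa [hn] using hS _ hz)
    simp only [EmbeddingLike.apply_eq_iff_eq] at this
    rcases this with rfl | rfl
    · exact lt_irrefl _ h1
    · exact lt_irrefl _ (hab.trans h2)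
  exact h₁.not_rectangle haa (fun h => hcc (π.injective h))
    (hD₁ a c hab hbc hab' hbc') (hD₁ a c₃ hab hbc₃ hab' hbc₃')
    (hD₁ a₂ c hab₂ hbc hab₂' hbc') (hD₁ a₂ c₃ hab₂ hbc₃ hab₂' hbc₃')

theorem is321_of_corner (h₁ : IsForest π D₁) (h₂ : IsForest π D₂) {x y : GridCell n n}
    (hx : x ∈ D₁ \ D₂) (hy : y ∈ D₂ \ D₁) (hxy : x.2 = π y.1) : ∃ a i c, Is321 π a i c := by
  obtain ⟨a, b, rfl, hab, hab'⟩ := h₁.exists_inversion_of_notMem h₂ hx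
  obtain ⟨b', c, rfl, hbc, hbc'⟩ := h₂.exists_inversion_of_notMem h₁ hy
  simp only [EmbeddingLike.apply_eq_iff_eq] at hxy
  subst hxy
  exact ⟨a, b, c, hab, hbc, hbc', hab'⟩

theorem IsForest.not_321 (h : IsForest π D) {a i c : Fin n} (hp : Is321 π a i c) :
    (a, π i) ∉ D ∨ (i, π c) ∉ D := by
  by_contra! hn
  exact h.not_both (h.leaf_mem i) hp.1 hn.1 hp.2.2.1 hn.2

/-- With one more admissible cell than dots, each CNAT misses exactly one admissible cell. -/
theorem exists_eq_erase_of_mem_CNATs (hn : 0 < n) (hcard : (permCells π).card = 2 * n)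
    (hD : D ∈ CNATs π) : ∃ e ∈ permCells π, D = (permCells π).erase e := by
  have hDf := (mem_CNATs_iff_card hn).1 hD
  have h1 : (permCells π \ D).card = 1 := by
    rw [Finset.card_sdiff_of_subset hDf.1.subset]
    omega
  obtain ⟨e, he⟩ := Finset.card_eq_one.1 h1
  refine ⟨e, ?_, ?_⟩
  · have : e ∈ permCells π \ D := by simp [he]
    exact (Finset.mem_sdiff.1 this).1
  · rw [← Finset.sdiff_singleton_eq_erase, ← he, Finset.sdiff_sdiff_eq_self hDf.1.subset]

theorem CNATs_eq_of_321 (hn : 0 < n) (hπ : IsIndecomposable π)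
    (hcard : (permCells π).card = 2 * n) {a i c : Fin n} (hp : Is321 π a i c) :
    CNATs π = {(permCells π).erase (a, π i), (permCells π).erase (i, π c)} := by
  have ha : (a, π i) ∈ permCells π := mem_permCells_of_inversion hp.1 hp.2.2.2
  have hc : (i, π c) ∈ permCells π := mem_permCells_of_inversion hp.2.1 hp.2.2.1
  have hall : ∀ D ∈ CNATs π,
      D = (permCells π).erase (a, π i) ∨ D = (permCells π).erase (i, π c) := by
    intro D hD
    obtain ⟨e, he, rfl⟩ := exists_eq_erase_of_mem_CNATs hn hcard hD
    rcases ((mem_CNATs_iff_card hn).1 hD).1.not_321 hp with h | h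
    · left
      rw [Finset.mem_erase, not_and_or, not_not] at h
      rw [h.resolve_right (not_not.2 ha)]
    · right
      rw [Finset.mem_erase, not_and_or, not_not] at h
      rw [h.resolve_right (not_not.2 hc)]
  obtain ⟨D, hD, hDa⟩ := exists_CNAT_mem hπ ha
  obtain ⟨D', hD', hDc⟩ := exists_CNAT_mem hπ hc
  ext E
  refine ⟨hall E, ?_⟩
  rintro (rfl | rfl)
  · rcases hall D' hD' with rfl | rfl
    · exact hD'
    · simp at hDc
  · rcases hall D hD with rfl | rfl
    · simp at hDa
    · exact hD

theorem cnat_eq_two_iff (hn : 0 < n) : cnat π = 2 ↔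
    IsIndecomposable π ∧ (permCells π).card = 2 * n ∧ ∃ a i c, Is321 π a i c := by
  constructor
  · intro h
    obtain ⟨D₁, D₂, hne, hD⟩ := Set.ncard_eq_two.1 h
    have hm₁ : D₁ ∈ CNATs π := by simp [hD]
    have hm₂ : D₂ ∈ CNATs π := by simp [hD]
    have hπ := isIndecomposable_of_mem_CNATs hm₁
    obtain ⟨h₁, hc₁⟩ := (mem_CNATs_iff_card hn).1 hm₁
    obtain ⟨h₂, hc₂⟩ := (mem_CNATs_iff_card hn).1 hm₂
    have hS : ∀ z ∈ permCells π, z ∈ D₁ ∨ z ∈ D₂ := by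
      intro z hz
      obtain ⟨D, hDm, hzD⟩ := exists_CNAT_mem hπ hz
      rw [hD] at hDm
      rcases hDm with rfl | rfl
      · exact Or.inl hzD
      · exact Or.inr hzD
    have hSU : permCells π = D₂ ∪ D₁ := by
      ext z
      rw [Finset.mem_union, or_comm]
      exact ⟨hS z, fun hz => hz.elim (fun hz => h₁.subset hz) fun hz => h₂.subset hz⟩
    have hK : ∀ x ∈ D₁ \ D₂, ∀ y ∈ D₂ \ D₁, x.2 = π y.1 ∨ y.2 = π x.1 :=
      fun x hx y hy => corner_of_CNATs_eq_pair hπ hD h₁ h₂ hx hy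
    have he₁ := Finset.card_sdiff_add_card D₁ D₂
    have he₂ := Finset.card_sdiff_add_card D₂ D₁
    rw [← hSU] at he₂
    rw [Finset.union_comm, ← hSU] at he₁
    have hpos : 0 < (D₁ \ D₂).card := by
      rw [Finset.card_pos, Finset.sdiff_nonempty]
      exact fun hsub => hne (Finset.eq_of_subset_of_card_le hsub (by omega))
    -- Both CNATs have `2 * n - 1` dots, so the two differences have equal size; size one gives `2 *
    -- n` admissible cells.
    have hone : (D₁ \ D₂).card = 1 := by
      by_contra hgt
      obtain ⟨x, x', hx, hx', hxx⟩ := Finset.one_lt_card_iff.1 (show 1 < (D₁ \ D₂).card by omega)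
      obtain ⟨y, y', hy, hy', hyy⟩ := Finset.one_lt_card_iff.1 (show 1 < (D₂ \ D₁).card by omega)
      rcases hK x hx y hy with hxy | hxy
      · exact not_corner_of_two_le h₁ h₂ hS hK hx hx' hxx hy hy' hyy hxy
      · exact not_corner_of_two_le h₂ h₁ (fun z hz => (hS z hz).symm)
          (fun y hy x hx => (hK x hx y hy).symm) hy hy' hyy hx hx' hxx hxy
    refine ⟨hπ, by omega, ?_⟩
    obtain ⟨x, hx⟩ := Finset.card_pos.1 hpos
    obtain ⟨y, hy⟩ := Finset.card_pos.1 (show 0 < (D₂ \ D₁).card by omega)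
    rcases hK x hx y hy with hxy | hxy
    · exact is321_of_corner h₁ h₂ hx hy hxy
    · exact is321_of_corner h₂ h₁ hy hx hxy
  · rintro ⟨hπ, hcard, a, i, c, hp⟩
    refine Set.ncard_eq_two.2 ⟨_, _, ?_, CNATs_eq_of_321 hn hπ hcard hp⟩
    intro h
    have hmem : (a, π i) ∈ (permCells π).erase (i, π c) :=
      Finset.mem_erase.2 ⟨fun h => hp.1.ne (Prod.mk.inj h).1,
        mem_permCells_of_inversion hp.1 hp.2.2.2⟩
    rw [← h] at hmem
    simp at hmem

/-- A permutation associated with two CNATs has only one decreasing sequence of length three. -/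
theorem is321_unique (hn : 0 < n) (hπ : IsIndecomposable π)
    (hcard : (permCells π).card = 2 * n) {a i c a' i' c' : Fin n} (hp : Is321 π a i c)
    (hp' : Is321 π a' i' c') : a = a' ∧ i = i' ∧ c = c' := by
  have h := CNATs_eq_of_321 hn hπ hcard hp
  rw [CNATs_eq_of_321 hn hπ hcard hp'] at h
  have hmem : ∀ {j k : Fin n}, j < k → π k < π j →
      (((permCells π).erase (a', π i') = (permCells π).erase (j, π k)) ∨
        ((permCells π).erase (i', π c') = (permCells π).erase (j, π k))) →
      (j = a' ∧ k = i') ∨ (j = i' ∧ k = c') := by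
    intro j k hjk hjk' h
    have hm : (j, π k) ∈ permCells π := mem_permCells_of_inversion hjk hjk'
    have key : ∀ x, (permCells π).erase x = (permCells π).erase (j, π k) → (j, π k) = x := by
      intro x hx
      by_contra hne
      have : (j, π k) ∈ (permCells π).erase x := Finset.mem_erase.2 ⟨hne, hm⟩
      rw [hx] at this
      simp at this
    rcases h with h | h
    · simpa using Or.inl (key _ h)
    · simpa using Or.inr (key _ h)
  have hA : (permCells π).erase (a, π i) ∈
      ({(permCells π).erase (a', π i'), (permCells π).erase (i', π c')} : Set _) := by
    rw [h]
    simp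
  have hB : (permCells π).erase (i, π c) ∈
      ({(permCells π).erase (a', π i'), (permCells π).erase (i', π c')} : Set _) := by
    rw [h]
    simp
  have h1 := hmem hp.1 hp.2.2.2 (by simpa [eq_comm] using hA)
  have h2 := hmem hp.2.1 hp.2.2.1 (by simpa [eq_comm] using hB)
  obtain ⟨p1, p2, -, -⟩ := hp
  obtain ⟨q1, q2, -, -⟩ := hp'
  -- The swapped matching of the two omitted cells would give `a' = i = c'`.
  grind

end

/-! ### Inserting and deleting a fixed point -/

section
variable {n : ℕ} {π : Equiv.Perm (Fin n)}

/-- If exactly one larger letter precedes the `i`-th letter and exactly one smaller letter follows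
it, then `i` is a fixed point. -/
theorem apply_eq_self_of_321 {a i c : Fin n} (hp : Is321 π a i c)
    (ha : ∀ a' < i, π i < π a' → a' = a) (hc : ∀ c' > i, π c' < π i → c' = c) : π i = i := by
  -- The letters before position `i` and the letters below `π i` differ by one exchange, so these
  -- sets have equal size.
  have h1 : ((Finset.Iio i).image π) \ Finset.Iio (π i) = {π a} := by
    ext r
    obtain ⟨k, rfl⟩ := π.surjective r
    simp only [Finset.mem_sdiff, Finset.mem_image, Finset.mem_Iio, EmbeddingLike.apply_eq_iff_eq,
      exists_eq_right, not_lt, Finset.mem_singleton]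
    constructor
    · rintro ⟨hk, hk'⟩
      exact ha k hk (lt_of_le_of_ne hk' fun h => hk.ne (π.injective h).symm)
    · rintro rfl
      exact ⟨hp.1, hp.2.2.2.le⟩
  have h2 : Finset.Iio (π i) \ ((Finset.Iio i).image π) = {π c} := by
    ext r
    obtain ⟨k, rfl⟩ := π.surjective r
    simp only [Finset.mem_sdiff, Finset.mem_image, Finset.mem_Iio, EmbeddingLike.apply_eq_iff_eq,
      exists_eq_right, not_lt, Finset.mem_singleton]
    constructor
    · rintro ⟨hk, hk'⟩
      exact hc k (lt_of_le_of_ne hk' fun h => hk.ne (by rw [h])) hk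
    · rintro rfl
      exact ⟨hp.2.2.1, hp.2.1.le⟩
  have h3 := Finset.card_sdiff_add_card ((Finset.Iio i).image π) (Finset.Iio (π i))
  have h4 := Finset.card_sdiff_add_card (Finset.Iio (π i)) ((Finset.Iio i).image π)
  rw [h1, Finset.card_singleton] at h3
  rw [h2, Finset.card_singleton, Finset.union_comm, ← h3,
    Finset.card_image_of_injective _ π.injective, Fin.card_Iio, Fin.card_Iio] at h4
  exact Fin.ext (by omega)

@[simp]
theorem insertFixedPoint_self (p : Fin (n + 1)) (π : Equiv.Perm (Fin n)) :
    insertFixedPoint p π p = p := by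
  simp [insertFixedPoint]

@[simp]
theorem insertFixedPoint_succAbove (p : Fin (n + 1)) (π : Equiv.Perm (Fin n)) (i : Fin n) :
    insertFixedPoint p π (p.succAbove i) = p.succAbove (π i) := by
  simp [insertFixedPoint]

theorem insertFixedPoint_symm (p : Fin (n + 1)) (π : Equiv.Perm (Fin n)) :
    (insertFixedPoint p π).symm = insertFixedPoint p π.symm := by
  ext1 i
  rw [Equiv.symm_apply_eq]
  rcases Fin.eq_self_or_eq_succAbove p i with rfl | ⟨i, rfl⟩ <;> simp

theorem insertFixedPoint_injective (p : Fin (n + 1)) :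
    Function.Injective (insertFixedPoint p) := by
  intro π σ h
  ext1 i
  have := congrArg (fun f => f (p.succAbove i)) h
  simpa using this

theorem exists_insertFixedPoint_eq {p : Fin (n + 1)} {σ : Equiv.Perm (Fin (n + 1))}
    (h : σ p = p) : ∃ π, insertFixedPoint p π = σ := by
  have h' : ∀ i, ∃ j, σ (p.succAbove i) = p.succAbove j := fun i =>
    (Fin.eq_self_or_eq_succAbove p (σ (p.succAbove i))).resolve_left fun hi =>
      Fin.succAbove_ne p i (σ.injective (hi.trans h.symm))
  choose f hf using h'
  have hinj : Function.Injective f := fun i j hij =>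
    Fin.succAbove_right_injective (p := p) (σ.injective (by rw [hf, hf, hij]))
  refine ⟨Equiv.ofBijective f (Finite.injective_iff_bijective.1 hinj), ?_⟩
  ext1 i
  rcases Fin.eq_self_or_eq_succAbove p i with rfl | ⟨i, rfl⟩
  · simp [h]
  · simp [hf]

theorem succAbove_lt_self_iff {p : Fin (n + 1)} {i : Fin n} :
    p.succAbove i < p ↔ (i : ℕ) < p := by
  rw [Fin.succAbove_lt_iff_castSucc_lt, Fin.lt_def, Fin.val_castSucc]

theorem self_lt_succAbove_iff {p : Fin (n + 1)} {i : Fin n} :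
    p < p.succAbove i ↔ (p : ℕ) ≤ i := by
  rw [Fin.lt_succAbove_iff_le_castSucc, Fin.le_def, Fin.val_castSucc]

theorem val_succAbove (p : Fin (n + 1)) (i : Fin n) :
    (p.succAbove i : ℕ) = if (i : ℕ) < p then (i : ℕ) else i + 1 := by
  rw [Fin.succAbove]
  simp only [Fin.lt_def, Fin.val_castSucc]
  split_ifs <;> simp

/-- A cut `k ≤ p` stays in place and a cut `k ≥ p` moves to `k + 1`; the cut at `p` yields both cuts
next to the new point. An end point would itself split off, hence the bounds on `p`. -/
theorem isIndecomposable_insertFixedPoint_iff {p : Fin (n + 1)} (h0 : 0 < (p : ℕ))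
    (hpn : (p : ℕ) < n) : IsIndecomposable (insertFixedPoint p π) ↔ IsIndecomposable π := by
  constructor
  · intro h k hk hkn
    by_cases hkp : k ≤ p
    · obtain ⟨i, hi, hi'⟩ := h k hk (by omega)
      rcases Fin.eq_self_or_eq_succAbove p i with rfl | ⟨i, rfl⟩
      · omega
      · refine ⟨i, ?_⟩
        rw [insertFixedPoint_succAbove] at hi'
        rw [val_succAbove] at hi hi'
        split_ifs at hi hi' <;> omega
    · obtain ⟨i, hi, hi'⟩ := h (k + 1) (by omega) (by omega)
      rcases Fin.eq_self_or_eq_succAbove p i with rfl | ⟨i, rfl⟩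
      · rw [insertFixedPoint_self] at hi'
        omega
      · refine ⟨i, ?_⟩
        rw [insertFixedPoint_succAbove] at hi'
        rw [val_succAbove] at hi hi'
        split_ifs at hi hi' <;> omega
  · intro h k hk hkn
    by_cases hkp : k ≤ p
    · obtain ⟨i, hi, hi'⟩ := h k hk (by omega)
      refine ⟨p.succAbove i, ?_⟩
      rw [insertFixedPoint_succAbove, val_succAbove, val_succAbove]
      split_ifs <;> omega
    · obtain ⟨i, hi, hi'⟩ := h (k - 1) (by omega) (by omega)
      refine ⟨p.succAbove i, ?_⟩
      rw [insertFixedPoint_succAbove, val_succAbove, val_succAbove]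
      split_ifs <;> omega

/-- A fixed point in the middle of exactly one decreasing sequence of length three contributes
three admissible cells. -/
theorem card_permCells_insertFixedPoint {p a c : Fin (n + 1)}
    (hp : Is321 (insertFixedPoint p π) a p c)
    (ha : ∀ a' < p, p < insertFixedPoint p π a' → a' = a)
    (hc : ∀ c' > p, insertFixedPoint p π c' < p → c' = c) :
    (permCells (insertFixedPoint p π)).card = (permCells π).card + 3 := by
  have hinj : Function.Injective (Prod.map p.succAbove p.succAbove) :=
    Fin.succAbove_right_injective.prodMap Fin.succAbove_right_injective
  have hap := hp.1
  have hpc := hp.2.1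
  have hcp' := hp.2.2.1
  have hap' := hp.2.2.2
  rw [insertFixedPoint_self] at hcp' hap'
  -- Old cells keep their relative order. In row or column `p`, a new cell is the leaf or comes from
  -- the only larger letter before, or the only smaller letter after, the fixed point.
  have hS : permCells (insertFixedPoint p π) =
      (permCells π).image (Prod.map p.succAbove p.succAbove) ∪
        {(p, p), (a, p), (p, insertFixedPoint p π c)} := by
    ext ⟨i, r⟩
    simp only [Finset.mem_union, Finset.mem_insert, Finset.mem_singleton, Prod.mk.injEq,
      Finset.mem_image, Prod.exists, Prod.map_apply]
    rw [mem_permCells]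
    rcases Fin.eq_self_or_eq_succAbove p r with rfl | ⟨r, rfl⟩
    · have h1 : ∀ k, r.succAbove k ≠ r := Fin.succAbove_ne r
      simp only [h1, and_false, exists_false, false_or, insertFixedPoint_symm,
        insertFixedPoint_self, and_true]
      constructor
      · rintro ⟨h2, h3⟩
        rcases h3.eq_or_lt with h3 | h3
        · exact Or.inl h3
        · refine Or.inr (Or.inl (ha i h3 (lt_of_le_of_ne h2 fun h => h3.ne ?_)))
          exact (insertFixedPoint r π).injective (by rw [← h, insertFixedPoint_self])
      · rintro (rfl | rfl | ⟨-, h⟩)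
        · simp
        · exact ⟨hap'.le, hap.le⟩
        · exact absurd h hcp'.ne'
    · rcases Fin.eq_self_or_eq_succAbove p i with rfl | ⟨i, rfl⟩
      · have h1 : ∀ k, i.succAbove k ≠ i := Fin.succAbove_ne i
        simp only [h1, false_and, exists_false, and_false, false_or, insertFixedPoint_self,
          true_and]
        constructor
        · rintro ⟨h2, h3⟩
          rw [← hc _ (lt_of_le_of_ne h3 ?_) ?_, Equiv.apply_symm_apply]
          · rw [insertFixedPoint_symm, insertFixedPoint_succAbove]
            exact (h1 _).symm
          · rw [Equiv.apply_symm_apply]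
            exact lt_of_le_of_ne h2 (h1 _)
        · intro h
          rw [h, Equiv.symm_apply_apply]
          exact ⟨hcp'.le, hpc.le⟩
      · simp only [insertFixedPoint_symm, insertFixedPoint_succAbove, Fin.succAbove_le_succAbove_iff,
          Fin.succAbove_ne, false_and, and_false, or_false, Fin.succAbove_right_inj]
        rw [← mem_permCells]
        simp
  rw [hS, Finset.card_union_of_disjoint, Finset.card_image_of_injective _ hinj]
  · congr 1
    rw [Finset.card_eq_three]
    exact ⟨_, _, _, fun h => hap.ne (Prod.mk.inj h).1.symm, fun h => hcp'.ne (Prod.mk.inj h).2.symm,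
      fun h => hap.ne (Prod.mk.inj h).1, rfl⟩
  · rw [Finset.disjoint_left]
    rintro ⟨i, r⟩ h
    simp only [Finset.mem_image, Prod.exists, Prod.map_apply, Prod.mk.injEq] at h
    obtain ⟨i, r, -, rfl, rfl⟩ := h
    simp [Fin.succAbove_ne]

/-- If `π` is associated with a single CNAT, then exactly one inversion of `π` crosses each cut. -/
theorem exists_crossing_inversion (hn : 0 < n) (h : cnat π = 1) {k : ℕ} (hk : 0 < k)
    (hkn : k < n) : ∃ a c : Fin n, (∀ i : Fin n, (i : ℕ) < k ∧ k ≤ π i ↔ i = a) ∧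
      ∀ i : Fin n, k ≤ (i : ℕ) ∧ (π i : ℕ) < k ↔ i = c := by
  have h1 := (cnat_eq_one_iff hn).1 h
  obtain ⟨hπ, hcard⟩ := h1
  obtain ⟨D, hD⟩ := Set.ncard_eq_one.1 h
  have hDm : D ∈ CNATs π := hD ▸ rfl
  obtain ⟨hf, hfc⟩ := (mem_CNATs_iff_card hn).1 hDm
  have hDS : D = permCells π := Finset.eq_of_subset_of_card_le hf.subset (by omega)
  set s : Finset (Fin n) := Finset.univ.filter fun i => (i : ℕ) < k with hs
  set t : Finset (Fin n) := s.image π.symm with ht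
  have hmt : ∀ i, i ∈ t ↔ (π i : ℕ) < k := by
    intro i
    simp [ht, hs, Equiv.symm_apply_eq]
  have hms : ∀ i, i ∈ s ↔ (i : ℕ) < k := by
    intro i
    simp [hs]
  have hst : (s \ t).card = (t \ s).card := by
    have h1 := Finset.card_sdiff_add_card s t
    have h2 := Finset.card_sdiff_add_card t s
    have h3 : t.card = s.card := Finset.card_image_of_injective _ π.symm.injective
    rw [Finset.union_comm] at h2
    omega
  have hpos : 0 < (s \ t).card := by
    obtain ⟨i, hi, hi'⟩ := hπ k hk hkn
    refine Finset.card_pos.2 ⟨i, ?_⟩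
    rw [Finset.mem_sdiff, hms, hmt]
    omega
  have hone : (s \ t).card = 1 := by
    by_contra hne
    obtain ⟨a, a', ha, ha', haa⟩ := Finset.one_lt_card_iff.1 (show 1 < (s \ t).card by omega)
    obtain ⟨c, c', hc, hc', hcc⟩ := Finset.one_lt_card_iff.1 (show 1 < (t \ s).card by omega)
    -- The only CNAT is all of `permCells π`, so two crossing positions on each side of the cut
    -- would span a rectangle in a forest.
    have key : ∀ {a c}, a ∈ s \ t → c ∈ t \ s → (a, π c) ∈ D := by
      intro a c ha hc
      rw [Finset.mem_sdiff, hms, hmt] at ha hc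
      rw [hDS]
      refine mem_permCells_of_inversion ?_ ?_ <;> rw [Fin.lt_def] <;> omega
    exact hf.not_rectangle haa (fun h => hcc (π.injective h)) (key ha hc) (key ha hc')
      (key ha' hc) (key ha' hc')
  obtain ⟨a, ha⟩ := Finset.card_eq_one.1 hone
  obtain ⟨c, hc⟩ := Finset.card_eq_one.1 (hst ▸ hone)
  refine ⟨a, c, fun i => ?_, fun i => ?_⟩
  · rw [← Finset.mem_singleton, ← ha, Finset.mem_sdiff, hms, hmt, not_lt]
  · rw [← Finset.mem_singleton, ← hc, Finset.mem_sdiff, hms, hmt, not_lt, and_comm]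

theorem cnat_insertFixedPoint (hn : 0 < n) (h : cnat π = 1) {p : Fin (n + 1)} (h0 : 0 < (p : ℕ))
    (hpn : (p : ℕ) < n) :
    cnat (insertFixedPoint p π) = 2 ∧ ∃ a c, Is321 (insertFixedPoint p π) a p c := by
  obtain ⟨a, c, ha, hc⟩ := exists_crossing_inversion hn h h0 hpn
  obtain ⟨hπ, hcard⟩ := (cnat_eq_one_iff hn).1 h
  have hp : Is321 (insertFixedPoint p π) (p.succAbove a) p (p.succAbove c) := by
    have h1 := (ha a).2 rfl
    have h2 := (hc c).2 rfl
    unfold Is321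
    rw [insertFixedPoint_self, insertFixedPoint_succAbove, insertFixedPoint_succAbove,
      succAbove_lt_self_iff, succAbove_lt_self_iff, self_lt_succAbove_iff, self_lt_succAbove_iff]
    exact ⟨h1.1, h2.1, h2.2, h1.2⟩
  have hcard' := card_permCells_insertFixedPoint hp
    (fun i hi hi' => by
      rcases Fin.eq_self_or_eq_succAbove p i with rfl | ⟨i, rfl⟩
      · exact absurd hi (lt_irrefl _)
      · rw [insertFixedPoint_succAbove, self_lt_succAbove_iff] at hi'
        rw [(ha i).1 ⟨succAbove_lt_self_iff.1 hi, hi'⟩])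
    (fun i hi hi' => by
      rcases Fin.eq_self_or_eq_succAbove p i with rfl | ⟨i, rfl⟩
      · exact absurd hi (lt_irrefl _)
      · rw [insertFixedPoint_succAbove, succAbove_lt_self_iff] at hi'
        rw [(hc i).1 ⟨self_lt_succAbove_iff.1 hi, hi'⟩])
  exact ⟨(cnat_eq_two_iff n.succ_pos).2 ⟨(isIndecomposable_insertFixedPoint_iff h0 hpn).2 hπ,
    by omega, _, _, _, hp⟩, _, _, hp⟩

theorem exists_insertFixedPoint_of_cnat_eq_two (hn : 0 < n) {σ : Equiv.Perm (Fin (n + 1))}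
    (h : cnat σ = 2) : ∃ (p : Fin (n + 1)) (π : Equiv.Perm (Fin n)),
      0 < (p : ℕ) ∧ (p : ℕ) < n ∧ cnat π = 1 ∧ insertFixedPoint p π = σ := by
  obtain ⟨hσ, hcard, a, p, c, hp⟩ := (cnat_eq_two_iff n.succ_pos).1 h
  have ha : ∀ a' < p, σ p < σ a' → a' = a := fun a' h1 h2 =>
    (is321_unique n.succ_pos hσ hcard ⟨h1, hp.2.1, hp.2.2.1, h2⟩ hp).1
  have hc : ∀ c' > p, σ c' < σ p → c' = c := fun c' h1 h2 =>
    (is321_unique n.succ_pos hσ hcard ⟨hp.1, h1, h2, hp.2.2.2⟩ hp).2.2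
  have hfix := apply_eq_self_of_321 hp ha hc
  obtain ⟨π, rfl⟩ := exists_insertFixedPoint_eq hfix
  have h0 : 0 < (p : ℕ) := (Nat.zero_le _).trans_lt (Fin.lt_def.1 hp.1)
  have hpn : (p : ℕ) < n := (Fin.lt_def.1 hp.2.1).trans_le (Nat.lt_succ_iff.1 c.2)
  rw [insertFixedPoint_self] at ha hc
  have hcard' := card_permCells_insertFixedPoint hp ha hc
  exact ⟨p, π, h0, hpn, (cnat_eq_one_iff hn).2
    ⟨(isIndecomposable_insertFixedPoint_iff h0 hpn).1 hσ, by omega⟩, rfl⟩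

end

/-! ### The bijection -/

theorem mainTheorem5 (n : ℕ) (hn : 2 ≤ n) :
    Set.BijOn
      (fun p : Set.Icc 2 n × Equiv.Perm (Fin n) => insertOp p.1 p.2)
      (Set.univ ×ˢ permsWithCNATs n 1)
      (permsWithCNATs (n + 1) 2) := by
  have hn0 : 0 < n := by omega
  have hins : ∀ (j : Set.Icc 2 n) (π : Equiv.Perm (Fin n)), cnat π = 1 →
      ∃ p : Fin (n + 1), (p : ℕ) = j - 1 ∧ insertOp j π = insertFixedPoint p π ∧
        cnat (insertFixedPoint p π) = 2 ∧ ∃ a c, Is321 (insertFixedPoint p π) a p c := by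
    intro j π hπ
    have h1 := j.2.1
    have h2 := j.2.2
    exact ⟨_, rfl, rfl, cnat_insertFixedPoint hn0 hπ (by simp only; omega) (by simp only; omega)⟩
  refine ⟨?_, ?_, ?_⟩
  · rintro ⟨j, π⟩ ⟨-, hπ⟩
    obtain ⟨p, -, h1, h2, -⟩ := hins j π hπ
    exact (congrArg cnat h1).trans h2
  · rintro ⟨j, π⟩ ⟨-, hπ⟩ ⟨j', π'⟩ ⟨-, hπ'⟩ heq
    obtain ⟨p, hp, h1, h2, a, c, h3⟩ := hins j π hπ
    obtain ⟨p', hp', h1', h2', a', c', h3'⟩ := hins j' π' hπ'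
    simp only [h1, h1'] at heq
    rw [← heq] at h3'
    obtain ⟨hσ, hcard, -⟩ := (cnat_eq_two_iff n.succ_pos).1 h2
    -- Both inserted points are the middle of the unique decreasing triple, so they coincide.
    obtain ⟨-, rfl, -⟩ := is321_unique n.succ_pos hσ hcard h3 h3'
    have hj := j.2.1
    have hj' := j'.2.1
    exact Prod.ext (Subtype.ext (by simp only; omega)) (insertFixedPoint_injective p heq)
  · intro σ hσ
    obtain ⟨p, π, h0, hpn, hπ, rfl⟩ := exists_insertFixedPoint_of_cnat_eq_two hn0 hσ
    -- `p` counts from `0` and `j` from `1`.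
    refine ⟨(⟨p + 1, by omega, by omega⟩, π), ⟨trivial, hπ⟩, ?_⟩
    simp [insertOp]
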